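/- Let $(\Omega,\mu)$ be a measure space, $H=L^2(\Omega,\mu)$ (real-valued), and let $V$ be a real Hilbert space that is continuously and densely embedded in $H$. Let $T>0$ and let $\mathfrak a:[0,T]\times V\times V\to\mathbb R$ be a non-autonomous closed form: $\mathfrak a(t,\cdot,\cdot)$ is bilinear for each $t$, $\mathfrak a(\cdot,u,v)$ is measurable for all $u,v\in V$, and there are constants $M,\omega\in\mathbb R$ and $\alpha>0$ with $|\mathfrak a(t,u,v)|\le M\|u\|_V\|v\|_V$ and $\mathfrak a(t,u,u)+\omega\|u\|_H^2\ge\alpha\|u\|_V^2$ for all $t\in[0,T]$ and $u,v\in V$. Let $\mathcal A(t)\in\mathcal L(V,V')$ be given by $\langle\mathcal A(t)u,v\rangle=\mathfrak a(t,u,v)$. Identify $h\in H$ with the functional $v\mapsto(h\mid v)_H$ in $V'$. Let $f\in L^2(0,T;V')$ and $u_0\in H$, and let $u\in H^1(0,T;V')\cap L^2(0,T;V)\subset C([0,T];H)$ be the solution, identified with its continuous $H$-valued representative, of $$\dot u(t)+\mathcal A(t)u(t)=f(t)\quad\text{for a.e. }t\in(0,T),\qquad u(0)=u_0.$$ Assume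 that $v\wedge 1:=\inf\{v,1\}\in V$ and $\mathfrak a(t,v\wedge 1,(v-1)^+)\ge 0$ for all $t\in[0,T]$ and all $v\in V$, and that $f\le 0$, i.e. for every $v\in V$ with $v\ge 0$ $\mu$-a.e. one has $\langle f(t),v\rangle\le 0$ for a.e. $t\in(0,T)$. If $u_0\le 1$ $\mu$-a.e., then $u(t)\le 1$ $\mu$-a.e. for all $t\in[0,T]$. In particular, if $u_0\le 0$ $\mu$-a.e., then $u(t)\le 0$ $\mu$-a.e. for all $t\in[0,T]$. -/

import Mathlib

open MeasureTheory Set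
open scoped ContDiff InnerProductSpace

noncomputable section

namespace NonAutonomous

section Truncation

variable {Ω : Type*} [MeasurableSpace Ω] {μ : Measure Ω}

lemma lipschitzWith_min_one : LipschitzWith 1 (fun x : ℝ => min x 1) :=
  LipschitzWith.id.min_const 1

lemma lipschitzWith_sub_one_pos : LipschitzWith 1 (fun x : ℝ => max (x - 1) 0) := by
  refine LipschitzWith.max_const ?_ 0
  exact LipschitzWith.of_dist_le_mul fun x y => by simp [Real.dist_eq]

/-- `v ∧ 1 = inf {v, 1}`, as an element of `L²(Ω, μ)` (the measure may be infinite). -/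
def infOne (v : Lp ℝ 2 μ) : Lp ℝ 2 μ :=
  lipschitzWith_min_one.compLp (by norm_num) v

/-- `(v - 1)⁺`, as an element of `L²(Ω, μ)`. -/
def subOnePos (v : Lp ℝ 2 μ) : Lp ℝ 2 μ :=
  lipschitzWith_sub_one_pos.compLp (by norm_num) v

lemma coeFn_infOne (v : Lp ℝ 2 μ) : ∀ᵐ x ∂μ, infOne v x = min (v x) 1 :=
  lipschitzWith_min_one.coeFn_compLp (by norm_num) v

lemma coeFn_subOnePos (v : Lp ℝ 2 μ) : ∀ᵐ x ∂μ, subOnePos v x = max (v x - 1) 0 :=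
  lipschitzWith_sub_one_pos.coeFn_compLp (by norm_num) v

lemma infOne_add_subOnePos (v : Lp ℝ 2 μ) : infOne v + subOnePos v = v := by
  apply Lp.ext
  filter_upwards [coeFn_infOne v, coeFn_subOnePos v, Lp.coeFn_add (infOne v) (subOnePos v)]
    with x h1 h2 h3
  rw [h3, Pi.add_apply, h1, h2]
  rcases le_total (v x) 1 with h | h
  · rw [min_eq_left h, max_eq_right (by linarith)]; ring
  · rw [min_eq_right h, max_eq_left (by linarith)]; ring

end Truncation

section Abstract

variable {V H : Type*} [NormedAddCommGroup V] [InnerProductSpace ℝ V]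
  [NormedAddCommGroup H] [InnerProductSpace ℝ H]

/-- Non-autonomous closed form on `H`: a family of bilinear forms `a(t,·,·)` on `V`, `t ∈ [0,T]`,
that is `V`-bounded uniformly in `t`, quasi-coercive uniformly in `t`, and (Lebesgue) measurable
in `t`. The embedding `V ↪ H` is `j`. The values of `a t` for `t ∉ [0,T]` play no role. -/
structure IsClosedForm (T : ℝ) (j : V →L[ℝ] H) (a : ℝ → V →ₗ[ℝ] V →ₗ[ℝ] ℝ) : Prop where
  bounded : ∃ M : ℝ, ∀ t ∈ Icc 0 T, ∀ u v : V, |a t u v| ≤ M * ‖u‖ * ‖v‖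
  quasiCoercive : ∃ om α : ℝ, 0 < α ∧
    ∀ t ∈ Icc 0 T, ∀ u : V, α * ‖u‖ ^ 2 ≤ a t u u + om * ‖j u‖ ^ 2
  measurable : ∀ u v : V, AEMeasurable (fun t => a t u v) (volume.restrict (Icc 0 T))

/-- The embedding `H ↪ V'` of the Gelfand triple: `⟨h, v⟩ = (h | v)_H`. -/
def toDual (j : V →L[ℝ] H) (h : H) : StrongDual ℝ V := (innerSL ℝ h).comp j

/-- `g` is the weak derivative of `w` on `(0, T)`. -/
def IsWeakDeriv {E : Type*} [NormedAddCommGroup E] [NormedSpace ℝ E]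
    (T : ℝ) (w g : ℝ → E) : Prop :=
  ∀ φ : ℝ → ℝ, ContDiff ℝ ∞ φ → HasCompactSupport φ → tsupport φ ⊆ Ioo 0 T →
    ∫ t in Ioo 0 T, deriv φ t • w t = -∫ t in Ioo 0 T, φ t • g t

/-- `w` is (a representative of) an element of `MR(V,V') = H¹(0,T;V') ∩ L²(0,T;V)`, with
derivative `w' ∈ L²(0,T;V')`. -/
structure IsMR (T : ℝ) (j : V →L[ℝ] H) (w : ℝ → V) (w' : ℝ → StrongDual ℝ V) : Prop where
  memLp : MemLp w 2 (volume.restrict (Ioo 0 T))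
  memLp_deriv : MemLp w' 2 (volume.restrict (Ioo 0 T))
  weakDeriv : IsWeakDeriv T (fun t => toDual j (j (w t))) w'

/-- `u : [0,T] → H` is the solution of `u' + 𝒜(t) u = f` a.e. on `(0,T)`, `u(0) = u₀`, in
`MR(V,V')`, where `⟨𝒜(t) v, z⟩ = a(t,v,z)`. As usual an element of `MR(V,V')` is identified with
its continuous representative with values in `H`; here that representative is `u`, and `w` is
the same function with values in `V`, defined a.e. -/
structure IsSolution (T : ℝ) (j : V →L[ℝ] H) (a : ℝ → V →ₗ[ℝ] V →ₗ[ℝ] ℝ)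
    (f : ℝ → StrongDual ℝ V) (u₀ : H) (u : ℝ → H) : Prop where
  continuousOn : ContinuousOn u (Icc 0 T)
  initial : u 0 = u₀
  equation : ∃ (w : ℝ → V) (w' : ℝ → StrongDual ℝ V), IsMR T j w w' ∧
    (∀ᵐ t ∂(volume.restrict (Ioo 0 T)), j (w t) = u t) ∧
    (∀ᵐ t ∂(volume.restrict (Ioo 0 T)), ∀ z : V, w' t z + a t (w t) z = f t z)

end Abstract

/-- `f ≤ 0` for `f ∈ L²(0,T;V')`: for all `0 ≤ v ∈ V`, `⟨f(t), v⟩ ≤ 0` for a.e. `t`. -/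
def DualNonpos {Ω : Type*} [MeasurableSpace Ω] {μ : Measure Ω}
    {V : Type*} [NormedAddCommGroup V] [InnerProductSpace ℝ V]
    (T : ℝ) (j : V →L[ℝ] Lp ℝ 2 μ) (f : ℝ → StrongDual ℝ V) : Prop :=
  ∀ v : V, (∀ᵐ x ∂μ, 0 ≤ j v x) → ∀ᵐ t ∂(volume.restrict (Ioo 0 T)), f t v ≤ 0

end NonAutonomous

end

/-! Let `ψ = ‖(u - 1)⁺‖²` in `H`. Testing the equation with `(u - 1)⁺`, where `f ≤ 0` and `a(t, u ∧
1, (u - 1)⁺) ≥ 0`, gives formally `ψ' ≤ 2 om ψ` by quasi-coercivity; since `ψ(0) = 0`, Gronwall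
forces `ψ = 0`.

No chain rule in `MR(V,V')` is used. By convexity (`norm_sq_subOnePos_sub_le`), `ψ(t) - ψ(t - h)` is
at most `2 ((u(t) - 1)⁺ | u(t) - u(t - h))`, an integral of `w'` against a vector frozen at time
`t`. Integrating in `t`, dividing by `h` and letting `h → 0` (`le_intervalIntegral_of_increment_le`)
needs only the continuity of translations in `L²`.

The null set in `f ≤ 0` depends on the test vector. To test with `(w(t) - 1)⁺`, the truncation must
be demicontinuous on `V`: it is bounded there by coercivity and continuous in `H`
(`norm_le_of_quasiCoercive`, `tendsto_apply_of_tendsto_of_injective`), so separability applies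
(`ae_apply_nonpos`). -/

namespace NonAutonomous

open Filter Topology

/-! ### Truncation in `L²` and its convexity inequality. -/

section Truncation

variable {Ω : Type*} [MeasurableSpace Ω] {μ : Measure Ω}

lemma continuous_subOnePos : Continuous (subOnePos : Lp ℝ 2 μ → Lp ℝ 2 μ) :=
  lipschitzWith_sub_one_pos.continuous_compLp (by norm_num)

lemma norm_subOnePos_le (v : Lp ℝ 2 μ) : ‖subOnePos v‖ ≤ ‖v‖ := by
  have h := lipschitzWith_sub_one_pos.norm_compLp_le (by norm_num) v
  rwa [NNReal.coe_one, one_mul] at h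

lemma subOnePos_eq_zero_iff (v : Lp ℝ 2 μ) : subOnePos v = 0 ↔ ∀ᵐ x ∂μ, v x ≤ 1 := by
  rw [Lp.eq_zero_iff_ae_eq_zero]
  refine eventually_congr ?_
  filter_upwards [coeFn_subOnePos v] with x hx
  rw [hx, Pi.zero_apply, max_eq_right_iff, sub_nonpos]

lemma subOnePos_nonneg (v : Lp ℝ 2 μ) : ∀ᵐ x ∂μ, 0 ≤ subOnePos v x := by
  filter_upwards [coeFn_subOnePos v] with x hx
  rw [hx]
  exact le_max_right _ _

/-- Wherever `(v - 1)⁺` is nonzero, `v ∧ 1 = 1 ≥ w ∧ 1`. -/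
lemma inner_subOnePos_infOne_sub_nonneg (v w : Lp ℝ 2 μ) :
    0 ≤ ⟪subOnePos v, infOne v - infOne w⟫_ℝ := by
  rw [L2.inner_def]
  refine integral_nonneg_of_ae ?_
  filter_upwards [coeFn_subOnePos v, coeFn_infOne v, coeFn_infOne w,
    Lp.coeFn_sub (infOne v) (infOne w)] with x h1 h2 h3 h4
  rw [h4, Pi.sub_apply, h1, h2, h3, Pi.zero_apply]
  change 0 ≤ (min (v x) 1 - min (w x) 1) * max (v x - 1) 0
  rcases le_total (v x) 1 with h | h
  · rw [max_eq_right (by linarith), mul_zero]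
  · rw [min_eq_right h]
    exact mul_nonneg (sub_nonneg.2 (min_le_right _ _)) (le_max_right _ _)

/-- Subgradient inequality for the convex functional `‖(v - 1)⁺‖²`, whose gradient is `2 (v - 1)⁺`.
It takes the place of a chain rule. -/
lemma norm_sq_subOnePos_sub_le (v w : Lp ℝ 2 μ) :
    ‖subOnePos v‖ ^ 2 - ‖subOnePos w‖ ^ 2 ≤ 2 * ⟪subOnePos v, v - w⟫_ℝ := by
  have h1 := inner_subOnePos_infOne_sub_nonneg v w
  have h2 : v - w = (infOne v - infOne w) + (subOnePos v - subOnePos w) := by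
    conv_lhs => rw [← infOne_add_subOnePos v, ← infOne_add_subOnePos w]
    abel
  have h3 : 0 ≤ ‖subOnePos v - subOnePos w‖ ^ 2 := sq_nonneg _
  rw [norm_sub_sq_real] at h3
  rw [h2, inner_add_right, inner_sub_right _ (subOnePos v), real_inner_self_eq_norm_sq]
  linarith

end Truncation

/-! ### Boundedness and weak convergence in `V`. -/

section GelfandTriple

variable {V H : Type*} [NormedAddCommGroup V] [InnerProductSpace ℝ V]
  [NormedAddCommGroup H] [InnerProductSpace ℝ H]

/-- The sign condition gives `b q q ≤ b v q`, so coercivity bounds `α ‖q‖²` by a multiple of `‖v‖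
‖q‖`. -/
lemma norm_le_of_quasiCoercive {j : V →L[ℝ] H} {b : V →ₗ[ℝ] V →ₗ[ℝ] ℝ} {M om α : ℝ}
    (hα : 0 < α) (hM : ∀ u v : V, |b u v| ≤ M * ‖u‖ * ‖v‖)
    (hb : ∀ u : V, α * ‖u‖ ^ 2 ≤ b u u + om * ‖j u‖ ^ 2) {v q : V}
    (hq : ‖j q‖ ≤ ‖j v‖) (hpos : 0 ≤ b (v - q) q) :
    ‖q‖ ≤ (M + |om| * ‖j‖ ^ 2) / α * ‖v‖ := by
  rw [div_mul_eq_mul_div, le_div_iff₀ hα]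
  rcases (norm_nonneg q).eq_or_lt with h0 | h0
  · rcases (norm_nonneg v).eq_or_lt with h1 | h1
    · rw [← h0, ← h1]; simp
    -- `M` carries no sign assumption; here `v ≠ 0` forces `0 ≤ M`.
    · have := (abs_nonneg _).trans (hM v v)
      have hM0 : 0 ≤ M := by
        rw [mul_assoc] at this
        exact nonneg_of_mul_nonneg_left this (by positivity)
      rw [← h0, zero_mul]
      positivity
  · refine le_of_mul_le_mul_right ?_ h0
    have h1 : b q q ≤ M * ‖v‖ * ‖q‖ := by
      have := (le_abs_self _).trans (hM v q)
      rw [map_sub, LinearMap.sub_apply] at hpos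
      linarith
    have h2 : om * ‖j q‖ ^ 2 ≤ |om| * ((‖j‖ * ‖v‖) * (‖j‖ * ‖q‖)) := by
      rw [sq]
      have := hq.trans (j.le_opNorm v)
      exact mul_le_mul (le_abs_self _)
        (mul_le_mul this (j.le_opNorm q) (norm_nonneg _) (by positivity)) (by positivity)
        (abs_nonneg _)
    nlinarith [hb q]

/-- Bounded families whose images under an injective operator converge are weakly convergent. -/
lemma tendsto_apply_of_tendsto_of_injective [CompleteSpace V] [CompleteSpace H] {j : V →L[ℝ] H}
    (hj : Function.Injective j) {ι : Type*} {l : Filter ι} {x : ι → V} {y : V} {R : ℝ}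
    (hx : ∀ i, ‖x i‖ ≤ R) (hlim : Tendsto (fun i => j (x i)) l (𝓝 (j y)))
    (φ : StrongDual ℝ V) : Tendsto (fun i => φ (x i)) l (𝓝 (φ y)) := by
  have hR : 0 < |R| + ‖y‖ + 1 := by positivity
  -- The closure of the range of `j*` is `(ker j)ᗮ = V`. Against `j* h` the pairing is `⟪h, j (x
  -- i)⟫`, which converges; boundedness of `x` extends this to all functionals.
  have hdense : Dense (Set.range (ContinuousLinearMap.adjoint j)) := by
    have hker : j.ker = ⊥ := LinearMap.ker_eq_bot.2 hj
    have h := j.orthogonal_ker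
    rw [hker, Submodule.bot_orthogonal_eq_top] at h
    have := (Submodule.dense_iff_topologicalClosure_eq_top).2 h.symm
    exact this
  set z : V := (InnerProductSpace.toDual ℝ V).symm φ with hz
  have hφ : ∀ v, φ v = ⟪z, v⟫_ℝ := fun v => by
    rw [hz, InnerProductSpace.toDual_symm_apply]
  simp only [hφ]
  rw [Metric.tendsto_nhds]
  intro ε hε
  obtain ⟨_, hh, h, rfl⟩ := Metric.dense_iff.1 hdense z (ε / (2 * (|R| + ‖y‖ + 1)))
    (by positivity)
  have hh' : ‖z - ContinuousLinearMap.adjoint j h‖ < ε / (2 * (|R| + ‖y‖ + 1)) := by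
    rwa [Metric.mem_ball, dist_comm, dist_eq_norm] at hh
  have hinner : Tendsto (fun i => ⟪h, j (x i)⟫_ℝ) l (𝓝 ⟪h, j y⟫_ℝ) :=
    tendsto_const_nhds.inner hlim
  filter_upwards [Metric.tendsto_nhds.1 hinner (ε / 2) (by positivity)] with i hi
  rw [Real.dist_eq, ← inner_sub_right] at hi ⊢
  rw [← map_sub, ← ContinuousLinearMap.adjoint_inner_left] at hi
  have e : ⟪z, x i - y⟫_ℝ = ⟪z - ContinuousLinearMap.adjoint j h, x i - y⟫_ℝ
      + ⟪ContinuousLinearMap.adjoint j h, x i - y⟫_ℝ := by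
    rw [inner_sub_left]; ring
  have hxy : ‖x i - y‖ ≤ |R| + ‖y‖ + 1 := by
    have := norm_sub_le (x i) y
    have := hx i
    have := le_abs_self R
    linarith
  have hb : |⟪z - ContinuousLinearMap.adjoint j h, x i - y⟫_ℝ| ≤ ε / 2 :=
    calc _ ≤ ‖z - ContinuousLinearMap.adjoint j h‖ * ‖x i - y‖ := abs_real_inner_le_norm _ _
      _ ≤ ε / (2 * (|R| + ‖y‖ + 1)) * (|R| + ‖y‖ + 1) := by gcongr
      _ = ε / 2 := by field_simp
  rw [e]
  calc _ ≤ _ := abs_add_le _ _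
    _ < ε / 2 + ε / 2 := by linarith
    _ = ε := by ring

end GelfandTriple

end NonAutonomous

namespace NonAutonomous

open Filter Topology

/-! ### Scalar weak derivatives and the fundamental theorem of calculus. -/

section WeakDerivative

open Real

lemma deriv_smoothTransition_of_nonpos {x : ℝ} (hx : x ≤ 0) : deriv smoothTransition x = 0 := by
  have h : IsLocalMin smoothTransition x := Eventually.of_forall fun y => by
    rw [smoothTransition.zero_of_nonpos hx]
    exact smoothTransition.nonneg y
  exact h.deriv_eq_zero

lemma deriv_smoothTransition_of_one_le {x : ℝ} (hx : 1 ≤ x) : deriv smoothTransition x = 0 := by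
  have h : IsLocalMax smoothTransition x := Eventually.of_forall fun y => by
    rw [smoothTransition.one_of_one_le hx]
    exact smoothTransition.le_one y
  exact h.deriv_eq_zero

lemma continuous_deriv_smoothTransition : Continuous (deriv smoothTransition) :=
  (smoothTransition.contDiff (n := 1)).continuous_deriv le_rfl

lemma integral_deriv_smoothTransition : ∫ x in (0 : ℝ)..1, deriv smoothTransition x = 1 := by
  rw [intervalIntegral.integral_deriv_eq_sub
    (fun x _ => ((smoothTransition.contDiff (n := 1)).differentiable one_ne_zero) x)
    (continuous_deriv_smoothTransition.intervalIntegrable _ _)]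
  simp

lemma hasDerivAt_smoothTransition_comp (c s r : ℝ) :
    HasDerivAt (fun r => smoothTransition (c * (r - s)))
      (c * deriv smoothTransition (c * (r - s))) r := by
  have h1 : HasDerivAt (fun r : ℝ => c * (r - s)) c r := by
    simpa using ((hasDerivAt_id r).sub_const s).const_mul c
  have h2 := ((smoothTransition.contDiff (n := 1)).differentiable one_ne_zero
    (c * (r - s))).hasDerivAt
  rw [mul_comm]
  exact h2.comp r h1

/-- The kernel lives on `[s, s + 1/c]`, inside `(0, T)`; the substitution `r = s + x/c` shows it to
be an approximate identity at `s`. -/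
lemma setIntegral_deriv_smoothTransition_mul {T s c : ℝ} (hs : 0 < s) (hc : 0 < c)
    (hsc : s + c⁻¹ < T) (y : ℝ → ℝ) :
    ∫ r in Ioo 0 T, c * deriv smoothTransition (c * (r - s)) * y r
      = ∫ x in (0 : ℝ)..1, deriv smoothTransition x * y (c⁻¹ * x + s) := by
  have hsupp : ∀ r, r ∉ Ioc s (s + c⁻¹) →
      c * deriv smoothTransition (c * (r - s)) * y r = 0 := by
    intro r hr
    rcases le_or_gt r s with h | h
    · rw [deriv_smoothTransition_of_nonpos
        (mul_nonpos_of_nonneg_of_nonpos hc.le (sub_nonpos.2 h))]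
      simp
    · have h' : s + c⁻¹ < r := by
        by_contra! h'
        exact hr ⟨h, h'⟩
      rw [deriv_smoothTransition_of_one_le]
      · simp
      · rw [← div_le_iff₀' hc, one_div]
        linarith
  have hsub : Ioc s (s + c⁻¹) ⊆ Ioo 0 T := fun r h => ⟨hs.trans h.1, h.2.trans_lt hsc⟩
  rw [setIntegral_eq_integral_of_forall_compl_eq_zero fun r hr => hsupp r fun h => hr (hsub h),
    ← intervalIntegral.integral_eq_integral_of_support_subset (a := s) (b := s + c⁻¹)
      (fun r hr => by_contra fun h => hr (hsupp r h))]
  have h := intervalIntegral.integral_comp_mul_add (a := 0) (b := 1)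
    (fun r => c * deriv smoothTransition (c * (r - s)) * y r) (inv_ne_zero hc.ne') s
  rw [mul_zero, zero_add, mul_one, inv_inv, smul_eq_mul, add_comm c⁻¹ s] at h
  have hc' := hc.ne'
  have h2 : ∀ x, c * (c⁻¹ * x + s - s) = x := fun x => by field_simp; ring
  simp only [h2, mul_assoc c, intervalIntegral.integral_const_mul] at h ⊢
  exact (mul_left_cancel₀ hc' h).symm

lemma tendsto_setIntegral_deriv_smoothTransition_mul {T s : ℝ} (hs : s ∈ Ioo 0 T) {y : ℝ → ℝ}
    (hy : Continuous y) :
    Tendsto (fun n : ℕ => ∫ r in Ioo 0 T, n * deriv smoothTransition (n * (r - s)) * y r)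
      atTop (𝓝 (y s)) := by
  have hn : Tendsto (fun n : ℕ => (n : ℝ)⁻¹) atTop (𝓝 0) := tendsto_inv_atTop_nhds_zero_nat
  have hev : ∀ᶠ n : ℕ in atTop, (∫ x in (0 : ℝ)..1, deriv smoothTransition x *
      y ((n : ℝ)⁻¹ * x + s)) =
      ∫ r in Ioo 0 T, n * deriv smoothTransition (n * (r - s)) * y r := by
    filter_upwards [hn.eventually_lt_const (sub_pos.2 hs.2), eventually_gt_atTop 0] with n h1 h2
    rw [setIntegral_deriv_smoothTransition_mul hs.1 (by exact_mod_cast h2) (by linarith)]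
  refine Tendsto.congr' hev ?_
  have hcont : Continuous fun δ : ℝ => ∫ x in (0 : ℝ)..1, deriv smoothTransition x *
      y (δ * x + s) := by
    refine intervalIntegral.continuous_parametric_intervalIntegral_of_continuous' ?_ 0 1
    have := continuous_deriv_smoothTransition
    unfold Function.uncurry
    fun_prop
  have h := (hcont.tendsto 0).comp hn
  simp only [zero_mul, zero_add, intervalIntegral.integral_mul_const,
    integral_deriv_smoothTransition, one_mul] at h
  exact h

/-- A continuous function with an integrable weak derivative is its primitive. -/
lemma intervalIntegral_eq_sub_of_isWeakDeriv {T : ℝ} {y g : ℝ → ℝ} (hy : Continuous y)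
    (hg : IntegrableOn g (Ioo 0 T)) (h : IsWeakDeriv T y g) {s t : ℝ} (hs : s ∈ Ioo 0 T)
    (ht : t ∈ Ioo 0 T) (hst : s ≤ t) : ∫ x in s..t, g x = y t - y s := by
  -- A smooth approximation of the indicator of `(s, t]`, whose derivative approximates `δ_s - δ_t`.
  set φ : ℕ → ℝ → ℝ := fun n r =>
    smoothTransition (n * (r - s)) - smoothTransition (n * (r - t)) with hφ
  have hn : Tendsto (fun n : ℕ => (n : ℝ)⁻¹) atTop (𝓝 0) := tendsto_inv_atTop_nhds_zero_nat
  have hderiv : ∀ n : ℕ, deriv (φ n) = fun r => n * deriv smoothTransition (n * (r - s))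
      - n * deriv smoothTransition (n * (r - t)) := fun n => funext fun r =>
    ((hasDerivAt_smoothTransition_comp n s r).sub (hasDerivAt_smoothTransition_comp n t r)).deriv
  have hsmooth : ∀ n : ℕ, ContDiff ℝ ∞ (φ n) := fun n => by
    have h : ContDiff ℝ ∞ smoothTransition := smoothTransition.contDiff (n := ⊤)
    exact (h.comp (contDiff_const.mul (contDiff_id.sub contDiff_const))).sub
      (h.comp (contDiff_const.mul (contDiff_id.sub contDiff_const)))
  have hL : Tendsto (fun n => ∫ r in Ioo 0 T, deriv (φ n) r • y r) atTop (𝓝 (y s - y t)) := by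
    refine ((tendsto_setIntegral_deriv_smoothTransition_mul hs hy).sub
      (tendsto_setIntegral_deriv_smoothTransition_mul ht hy)).congr fun n => ?_
    have hi : ∀ p : ℝ, IntegrableOn
        (fun r => n * deriv smoothTransition (n * (r - p)) * y r) (Ioo 0 T) := fun p => by
      have := continuous_deriv_smoothTransition
      exact (Continuous.integrableOn_Icc (by fun_prop)).mono_set Ioo_subset_Icc_self
    rw [← integral_sub (hi s) (hi t)]
    simp only [hderiv, smul_eq_mul, sub_mul]
  have hR : Tendsto (fun n => ∫ r in Ioo 0 T, φ n r • g r) atTop (𝓝 (∫ x in s..t, g x)) := by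
    have hsub : Ioc s t ⊆ Ioo 0 T := fun x hx => ⟨hs.1.trans hx.1, hx.2.trans_lt ht.2⟩
    have hlim : ∫ x in s..t, g x = ∫ r in Ioo 0 T, (Ioc s t).indicator g r := by
      rw [intervalIntegral.integral_of_le hst, setIntegral_indicator measurableSet_Ioc,
        inter_eq_self_of_subset_right hsub]
    rw [hlim]
    refine tendsto_integral_of_dominated_convergence (fun r => ‖g r‖)
      (fun n => (hsmooth n).continuous.aestronglyMeasurable.smul hg.aestronglyMeasurable)
      hg.norm (fun n => Eventually.of_forall fun r => ?_) (Eventually.of_forall fun r => ?_)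
    · rw [norm_smul]
      refine mul_le_of_le_one_left (norm_nonneg _) ?_
      rw [Real.norm_eq_abs, abs_le]
      have h1 := smoothTransition.nonneg (n * (r - s))
      have h2 := smoothTransition.le_one (n * (r - s))
      have h3 := smoothTransition.nonneg (n * (r - t))
      have h4 := smoothTransition.le_one (n * (r - t))
      constructor <;> simp only [hφ] <;> linarith
    · have key : ∀ p : ℝ, ∀ᶠ n : ℕ in atTop,
          smoothTransition (n * (r - p)) = if p < r then 1 else 0 := fun p => by
        split_ifs with hp
        · filter_upwards [hn.eventually_lt_const (sub_pos.2 hp), eventually_gt_atTop 0]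
            with n h1 h2
          refine smoothTransition.one_of_one_le ?_
          have h2' : (0 : ℝ) < n := by exact_mod_cast h2
          rw [← div_le_iff₀' h2', one_div]
          exact h1.le
        · exact Eventually.of_forall fun n => smoothTransition.zero_of_nonpos
            (mul_nonpos_of_nonneg_of_nonpos (Nat.cast_nonneg n) (by linarith))
      refine tendsto_const_nhds.congr' ?_
      filter_upwards [key s, key t] with n h1 h2
      simp only [hφ, h1, h2, indicator, mem_Ioc, smul_eq_mul]
      by_cases h3 : s < r <;> by_cases h4 : t < r
      · simp [h3, h4]
      · simp [h3, h4, not_lt.1 h4]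
      · exact absurd (hst.trans_lt h4) h3
      · simp [h3, h4]
  have heq : ∀ᶠ n in atTop, ∫ r in Ioo 0 T, deriv (φ n) r • y r
      = -∫ r in Ioo 0 T, φ n r • g r := by
    filter_upwards [hn.eventually_lt_const (sub_pos.2 ht.2), eventually_gt_atTop 0] with n h1 h2
    have h2' : (0 : ℝ) < n := by exact_mod_cast h2
    have hsub : tsupport (φ n) ⊆ Icc s (t + (n : ℝ)⁻¹) := by
      refine closure_minimal (fun r hr => ?_) isClosed_Icc
      by_contra hr'
      refine hr ?_
      rw [mem_Icc, not_and_or, not_le, not_le] at hr'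
      simp only [hφ]
      rcases hr' with h | h
      · rw [smoothTransition.zero_of_nonpos
            (mul_nonpos_of_nonneg_of_nonpos h2'.le (by linarith)),
          smoothTransition.zero_of_nonpos
            (mul_nonpos_of_nonneg_of_nonpos h2'.le (by linarith)), sub_zero]
      · rw [smoothTransition.one_of_one_le, smoothTransition.one_of_one_le, sub_self] <;>
        · rw [← div_le_iff₀' h2', one_div]
          linarith
    exact h (φ n) (hsmooth n) (HasCompactSupport.of_support_subset_isCompact isCompact_Icc
      (subset_closure.trans hsub)) (hsub.trans fun r hr => ⟨hs.1.trans_le hr.1, by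
        have := hr.2
        linarith⟩)
  have := tendsto_nhds_unique (hL.congr' heq) hR.neg
  linarith

end WeakDerivative

end NonAutonomous

namespace NonAutonomous

open Filter Topology

/-! ### Difference quotients and translations in `L²`. -/

section Translation

variable {E : Type*} [NormedAddCommGroup E]

lemma tendsto_eLpNorm_translate_sub {g : ℝ → E} (hg : MemLp g 2) :
    Tendsto (fun y : ℝ => eLpNorm (fun t => g (t - y) - g t) 2 volume) (𝓝 0) (𝓝 0) := by
  have : Fact ((2 : ENNReal) ≠ ⊤) := ⟨by norm_num⟩
  set G : Lp E 2 (volume : Measure ℝ) := hg.toLp g with hG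
  have hc : Continuous fun y : ℝ => ‖((DomAddAct.mk (-y) : ℝᵈᵃᵃ) +ᵥ G) - G‖ₑ := by
    have h1 : Continuous fun y : ℝ => (DomAddAct.mk (-y) : ℝᵈᵃᵃ) :=
      (DomAddAct.continuous_mk (M := ℝ)).comp continuous_neg
    exact ((h1.vadd continuous_const).sub continuous_const).enorm
  have h0 := hc.tendsto 0
  have hz : ‖((DomAddAct.mk (-(0 : ℝ)) : ℝᵈᵃᵃ) +ᵥ G) - G‖ₑ = 0 := by simp
  rw [hz] at h0
  refine h0.congr fun y => ?_
  rw [hG, DomAddAct.mk_vadd_toLp, ← MemLp.toLp_sub, Lp.enorm_toLp]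
  congr 1
  ext t
  simp [sub_eq_neg_add]

lemma memLp_translate_sub {g : ℝ → E} (hg : MemLp g 2) (y : ℝ) :
    MemLp (fun t => g (t - y) - g t) 2 :=
  (hg.comp_measurePreserving (measurePreserving_sub_right volume y)).sub hg

lemma integrable_norm_translate_sub_mul {g : ℝ → E} (hg : MemLp g 2) {m : ℝ → ℝ}
    (hm : MemLp m 2) (y : ℝ) : Integrable fun t => ‖g (t - y) - g t‖ * m t :=
  (memLp_translate_sub hg y).norm.integrable_mul hm

lemma tendsto_integral_norm_translate_sub_mul {g : ℝ → E} (hg : MemLp g 2) {m : ℝ → ℝ}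
    (hm : MemLp m 2) :
    Tendsto (fun y : ℝ => ∫ t, ‖g (t - y) - g t‖ * m t) (𝓝 0) (𝓝 0) := by
  have hlim : Tendsto (fun y : ℝ => (eLpNorm (fun t => g (t - y) - g t) 2 volume
      * eLpNorm m 2 volume).toReal) (𝓝 0) (𝓝 0) := by
    have h := ENNReal.Tendsto.mul_const (b := eLpNorm m 2 volume)
      (tendsto_eLpNorm_translate_sub hg) (Or.inr hm.eLpNorm_ne_top)
    rw [zero_mul] at h
    exact (ENNReal.tendsto_toReal ENNReal.zero_ne_top).comp h
  refine squeeze_zero_norm (fun y => ?_) hlim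
  have hd := memLp_translate_sub hg y
  calc _ ≤ ∫ t, ‖‖g (t - y) - g t‖ * m t‖ := norm_integral_le_integral_norm _
    _ = (eLpNorm (fun t => ‖g (t - y) - g t‖ * m t) 1 volume).toReal := by
        rw [eLpNorm_one_eq_lintegral_enorm, integral_norm_eq_lintegral_enorm
          (integrable_norm_translate_sub_mul hg hm y).aestronglyMeasurable]
    _ ≤ _ := by
        refine ENNReal.toReal_mono (ENNReal.mul_ne_top hd.eLpNorm_ne_top hm.eLpNorm_ne_top) ?_
        have h := eLpNorm_smul_le_mul_eLpNorm (p := 2) (q := 2) (r := 1)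
          hm.aestronglyMeasurable hd.norm.aestronglyMeasurable
        rw [eLpNorm_norm] at h
        exact h

/-- After integration over `(σ, τ]` the left side telescopes to integrals of `ψ` over intervals of
length `h` ending at `τ` and `σ`. By Fubini the error is `o(h)`, since translations are continuous
in `L²`. -/
lemma le_intervalIntegral_of_increment_le {g : ℝ → E} (hg : MemLp g 2)
    (hgm : StronglyMeasurable g) {m : ℝ → ℝ} (hm : MemLp m 2) (hmm : StronglyMeasurable m)
    (hm0 : ∀ t, 0 ≤ m t) {ψ k : ℝ → ℝ} (hψ : Continuous ψ) (hk : Continuous k) {σ τ : ℝ}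
    (hστ : σ ≤ τ) {δ : ℝ} (hδ : 0 < δ)
    (hincr : ∀ᵐ t, t ∈ Ioc σ τ → ∀ h ∈ Ioo 0 δ,
      ψ t - ψ (t - h) ≤ h * k t + ∫ y in (0 : ℝ)..h, ‖g (t - y) - g t‖ * m t) :
    ψ τ - ψ σ ≤ ∫ t in σ..τ, k t := by
  refine le_of_forall_pos_le_add fun ε hε => ?_
  obtain ⟨d1, hd1, h1⟩ := Metric.eventually_nhds_iff.1
    ((tendsto_integral_norm_translate_sub_mul hg hm).eventually_lt_const
      (show (0 : ℝ) < ε / 3 by positivity))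
  obtain ⟨d2, hd2, h2⟩ := Metric.continuous_iff.1 hψ τ (ε / 3) (by positivity)
  obtain ⟨d3, hd3, h3⟩ := Metric.continuous_iff.1 hψ σ (ε / 3) (by positivity)
  -- So small that the translation error and the oscillations of `ψ` at `τ` and `σ` each cost at
  -- most `ε / 3`.
  set h := min (min δ d1) (min d2 d3) / 2 with hh
  have hpos : 0 < h := by positivity
  have hlt : h < min (min δ d1) (min d2 d3) := half_lt_self (by positivity)
  simp only [lt_min_iff] at hlt
  obtain ⟨⟨hl0, hl1⟩, hl2, hl3⟩ := hlt
  set D : ℝ × ℝ → ℝ := fun p => ‖g (p.1 - p.2) - g p.1‖ * m p.1 with hD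
  have hD0 : ∀ p, 0 ≤ D p := fun p => mul_nonneg (norm_nonneg _) (hm0 _)
  have hDm : StronglyMeasurable D :=
    ((hgm.comp_measurable (measurable_fst.sub measurable_snd)).sub
      (hgm.comp_measurable measurable_fst)).norm.mul (hmm.comp_measurable measurable_fst)
  have hyint : ∀ y, Integrable (fun t => D (t, y)) := integrable_norm_translate_sub_mul hg hm
  have hEle : ∀ y ∈ Ioc 0 h, ∫ t in Ioc σ τ, D (t, y) ≤ ε / 3 := fun y hy =>
    (setIntegral_le_integral (hyint y) (Eventually.of_forall fun t => hD0 _)).trans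
      (h1 (by rw [dist_zero_right, Real.norm_eq_abs, abs_of_pos hy.1]; linarith [hy.2])).le
  have hE0 : ∀ y, 0 ≤ ∫ t in Ioc σ τ, D (t, y) := fun y => integral_nonneg fun t => hD0 _
  have hEint : IntegrableOn (fun y => ∫ t in Ioc σ τ, D (t, y)) (Ioc 0 h) := by
    refine Measure.integrableOn_of_bounded (M := ε / 3) (by simp)
      hDm.integral_prod_left'.aestronglyMeasurable ?_
    filter_upwards [ae_restrict_mem measurableSet_Ioc] with y hy
    rw [Real.norm_eq_abs, abs_of_nonneg (hE0 y)]
    exact hEle y hy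
  have hDint : Integrable D
      ((volume.restrict (Ioc σ τ)).prod (volume.restrict (Ioc 0 h))) := by
    rw [integrable_prod_iff' hDm.aestronglyMeasurable]
    refine ⟨Eventually.of_forall fun y => (hyint y).integrableOn, ?_⟩
    simp only [Real.norm_eq_abs, abs_of_nonneg (hD0 _)]
    exact hEint
  have hI : ∫ t in Ioc σ τ, ∫ y in Ioc 0 h, D (t, y) ≤ h * (ε / 3) := by
    rw [integral_integral_swap (f := fun t y => D (t, y)) hDint]
    calc _ ≤ ∫ y in Ioc 0 h, ε / 3 :=
          setIntegral_mono_on hEint (integrable_const _) measurableSet_Ioc hEle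
      _ = h * (ε / 3) := by simp [hpos.le]
  have hle : ∫ t in σ..τ, (ψ t - ψ (t - h)) ≤ h * (∫ t in σ..τ, k t) + h * (ε / 3) := by
    rw [intervalIntegral.integral_of_le hστ, intervalIntegral.integral_of_le hστ]
    have hi2 : IntegrableOn (fun t => h * k t) (Ioc σ τ) :=
      (Continuous.integrableOn_Icc (by fun_prop)).mono_set Ioc_subset_Icc_self
    calc _ ≤ ∫ t in Ioc σ τ, (h * k t + ∫ y in Ioc 0 h, D (t, y)) := by
          refine setIntegral_mono_on_ae ?_ (hi2.add hDint.integral_prod_left) measurableSet_Ioc ?_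
          · exact (Continuous.integrableOn_Icc (by fun_prop)).mono_set Ioc_subset_Icc_self
          · filter_upwards [hincr] with t ht hts
            have := ht hts h ⟨hpos, hl0⟩
            rwa [intervalIntegral.integral_of_le hpos.le] at this
      _ = h * (∫ t in Ioc σ τ, k t) + ∫ t in Ioc σ τ, ∫ y in Ioc 0 h, D (t, y) := by
          rw [integral_add hi2 hDint.integral_prod_left, integral_const_mul]
      _ ≤ _ := by gcongr
  have hii : ∀ a b, IntervalIntegrable ψ volume a b := hψ.intervalIntegrable
  have hshift : ∫ t in σ..τ, (ψ t - ψ (t - h))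
      = (∫ t in (τ - h)..τ, ψ t) - ∫ t in (σ - h)..σ, ψ t := by
    rw [intervalIntegral.integral_sub (hii _ _)
        ((show Continuous fun t => ψ (t - h) by fun_prop).intervalIntegrable _ _),
      intervalIntegral.integral_comp_sub_right (fun t => ψ t) h,
      ← intervalIntegral.integral_add_adjacent_intervals (hii (τ - h) σ) (hii σ τ),
      ← intervalIntegral.integral_add_adjacent_intervals (hii (σ - h) σ) (hii σ (τ - h)),
      intervalIntegral.integral_symm (τ - h) σ]
    ring
  have hlow : h * (ψ τ - ε / 3) ≤ ∫ t in (τ - h)..τ, ψ t := by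
    calc _ = ∫ t in (τ - h)..τ, (ψ τ - ε / 3) := by
          rw [intervalIntegral.integral_const, sub_sub_cancel, smul_eq_mul]
      _ ≤ _ := by
        refine intervalIntegral.integral_mono_on (by linarith)
          (continuous_const.intervalIntegrable _ _) (hii _ _) fun t ht => ?_
        have := (abs_lt.1 (h2 t (by rw [Real.dist_eq, abs_lt]; constructor <;>
          linarith [ht.1, ht.2]))).1
        linarith
  have hup : ∫ t in (σ - h)..σ, ψ t ≤ h * (ψ σ + ε / 3) := by
    calc _ ≤ ∫ t in (σ - h)..σ, (ψ σ + ε / 3) := by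
          refine intervalIntegral.integral_mono_on (by linarith) (hii _ _)
            (continuous_const.intervalIntegrable _ _) fun t ht => ?_
          have := (abs_lt.1 (h3 t (by rw [Real.dist_eq, abs_lt]; constructor <;>
            linarith [ht.1, ht.2]))).2
          linarith
      _ = _ := by rw [intervalIntegral.integral_const, sub_sub_cancel, smul_eq_mul]
  rw [hshift] at hle
  have : h * (ψ τ - ψ σ) ≤ h * ((∫ t in σ..τ, k t) + ε) := by linarith
  exact le_of_mul_le_mul_left this hpos

end Translation

/-- Gronwall for the primitive `F` of `ψ`: letting `σ → 0` gives `F' ≤ K F` with `F(0) = 0`. -/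
lemma eq_zero_of_le_mul_integral {ψ : ℝ → ℝ} (hψ : Continuous ψ) (h0 : ∀ t, 0 ≤ ψ t) {T K : ℝ}
    (hψ0 : ψ 0 = 0)
    (hle : ∀ σ ∈ Ioo 0 T, ∀ τ ∈ Ioo 0 T, σ ≤ τ → ψ τ - ψ σ ≤ K * ∫ t in σ..τ, ψ t) :
    ∀ t ∈ Ico 0 T, ψ t = 0 := by
  have hder : ∀ t, HasDerivAt (fun t => ∫ s in (0 : ℝ)..t, ψ s) (ψ t) t := fun t =>
    intervalIntegral.integral_hasDerivAt_right (hψ.intervalIntegrable _ _)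
      hψ.stronglyMeasurable.stronglyMeasurableAtFilter hψ.continuousAt
  have hle0 : ∀ τ ∈ Ioo 0 T, ψ τ ≤ K * ∫ t in (0 : ℝ)..τ, ψ t := by
    intro τ hτ
    have hc : Continuous fun σ => K * (∫ t in σ..τ, ψ t) - (ψ τ - ψ σ) := by
      have : Continuous fun σ => ∫ t in σ..τ, ψ t := by
        simp_rw [intervalIntegral.integral_symm τ]
        exact (intervalIntegral.continuous_primitive (fun a b => hψ.intervalIntegrable a b) τ).neg
      fun_prop
    have hlim := (hc.tendsto 0).mono_left (nhdsWithin_le_nhds (s := Ioi 0))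
    have := ge_of_tendsto hlim (b := 0) (by
      filter_upwards [Ioo_mem_nhdsGT hτ.1] with σ hσ
      exact sub_nonneg.2 (hle σ ⟨hσ.1, hσ.2.trans hτ.2⟩ τ hτ hσ.2.le))
    rw [hψ0] at this
    linarith
  have hint0 : ∀ t, 0 ≤ t → 0 ≤ ∫ s in (0 : ℝ)..t, ψ s := fun t ht =>
    intervalIntegral.integral_nonneg ht fun s _ => h0 s
  intro τ hτ
  rcases hτ.1.eq_or_lt with rfl | hτ0
  · exact hψ0
  have hF := eq_zero_of_abs_deriv_le_mul_abs_self_of_eq_zero_right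
    (f := fun t => ∫ s in (0 : ℝ)..t, ψ s) (f' := ψ) (K := K) (a := 0) (b := τ)
    (fun t _ => (hder t).continuousAt.continuousWithinAt)
    (fun t _ => (hder t).hasDerivWithinAt) (by simp) (fun t ht => by
      rw [Real.norm_eq_abs, Real.norm_eq_abs, abs_of_nonneg (h0 t), abs_of_nonneg (hint0 t ht.1)]
      rcases ht.1.eq_or_lt with rfl | h
      · simp [hψ0]
      · exact hle0 t ⟨h, ht.2.trans hτ.2⟩) τ ⟨hτ.1, le_rfl⟩
  refine le_antisymm ?_ (h0 τ)
  have := hle0 τ ⟨hτ0, hτ.2⟩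
  rwa [hF, mul_zero] at this

end NonAutonomous

namespace NonAutonomous

open Filter Topology

/-- Extension by zero makes translates available on the whole line; strong measurability serves
Fubini. -/
lemma exists_stronglyMeasurable_memLp_of_restrict {α E : Type*} [MeasurableSpace α]
    [NormedAddCommGroup E] {ν : Measure α} {p : ENNReal} {s : Set α} (hs : MeasurableSet s)
    {f : α → E} (hf : MemLp f p (ν.restrict s)) :
    ∃ g : α → E, StronglyMeasurable g ∧ MemLp g p ν ∧ ∀ᵐ t ∂ν, t ∈ s → g t = f t := by
  have h : MemLp (s.indicator f) p ν := (memLp_indicator_iff_restrict hs).2 hf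
  refine ⟨_, h.aestronglyMeasurable.stronglyMeasurable_mk,
    (memLp_congr_ae h.aestronglyMeasurable.ae_eq_mk).1 h, ?_⟩
  filter_upwards [h.aestronglyMeasurable.ae_eq_mk] with t h1 h2
  rw [← h1, indicator_of_mem h2]

/-! ### Tested increments, null sets and scaling of solutions. -/

section Solution

variable {V H : Type*} [NormedAddCommGroup V] [InnerProductSpace ℝ V]
  [NormedAddCommGroup H] [InnerProductSpace ℝ H]

lemma IsWeakDeriv.apply {T : ℝ} {w g : ℝ → StrongDual ℝ V} (h : IsWeakDeriv T w g)
    (hw : IntegrableOn w (Ioo 0 T)) (hg : IntegrableOn g (Ioo 0 T)) (v : V) :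
    IsWeakDeriv T (fun t => w t v) (fun t => g t v) := by
  intro φ hφ hφc hφs
  have hint : ∀ {χ : ℝ → ℝ} {y : ℝ → StrongDual ℝ V}, Continuous χ → HasCompactSupport χ →
      IntegrableOn y (Ioo 0 T) → IntegrableOn (fun t => χ t • y t) (Ioo 0 T) := by
    intro χ y hχ hχc hy
    obtain ⟨C, hC⟩ := hχc.exists_bound_of_continuous hχ
    exact hy.bdd_smul C hχ.aestronglyMeasurable (Eventually.of_forall hC)
  have h1 := congrArg (fun L : StrongDual ℝ V => L v) (h φ hφ hφc hφs)
  simp only [neg_apply] at h1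
  rw [ContinuousLinearMap.integral_apply (hint (hφ.continuous_deriv (by simp)) hφc.deriv hw),
    ContinuousLinearMap.integral_apply (hint hφ.continuous hφc hg)] at h1
  simpa using h1

/-- Pairing with a fixed `v` leaves a continuous scalar function with an integrable weak derivative.
-/
lemma IsMR.inner_sub_eq_intervalIntegral {T : ℝ} {j : V →L[ℝ] H} {w : ℝ → V}
    {w' : ℝ → StrongDual ℝ V} (h : IsMR T j w w') {u : ℝ → H} (hu : Continuous u)
    (huw : ∀ᵐ t ∂(volume.restrict (Ioo 0 T)), j (w t) = u t) {s t : ℝ} (hs : s ∈ Ioo 0 T)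
    (ht : t ∈ Ioo 0 T) (hst : s ≤ t) (v : V) :
    ⟪j v, u t - u s⟫_ℝ = ∫ x in s..t, w' x v := by
  have hw'i : IntegrableOn w' (Ioo 0 T) := h.memLp_deriv.integrable (by norm_num)
  have hwi : IntegrableOn w (Ioo 0 T) := h.memLp.integrable (by norm_num)
  have hdi : IntegrableOn (fun t => toDual j (j (w t))) (Ioo 0 T) := by
    have := (((ContinuousLinearMap.compL ℝ V H ℝ).flip j).comp
      ((innerSL ℝ (E := H)).comp j)).integrable_comp hwi
    exact this
  have hwd : IsWeakDeriv T (fun t => ⟪u t, j v⟫_ℝ) (fun t => w' t v) := by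
    intro φ hφ hφc hφs
    rw [← h.weakDeriv.apply hdi hw'i v φ hφ hφc hφs]
    refine integral_congr_ae ?_
    filter_upwards [huw] with t ht
    rw [← ht]
    rfl
  rw [intervalIntegral_eq_sub_of_isWeakDeriv (hu.inner continuous_const)
    (hw'i.apply_continuousLinearMap v) hwd hs ht hst, real_inner_comm, inner_sub_left]

/-- If `f(t)` is a.e. nonpositive at every point of the range of the demicontinuous map `Q`, then
`f(t)` is nonpositive at `Q (w t)` for a.e. `t`. -/
lemma ae_apply_nonpos {T : ℝ} {Q : V → V}
    (hQ : ∀ (v : V) (d : ℕ → V), Tendsto d atTop (𝓝 v) → ∀ φ : StrongDual ℝ V,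
      Tendsto (fun n => φ (Q (d n))) atTop (𝓝 (φ (Q v))))
    {f : ℝ → StrongDual ℝ V} (hf : ∀ v, ∀ᵐ t ∂(volume.restrict (Ioo 0 T)), f t (Q v) ≤ 0)
    {w : ℝ → V} (hw : AEStronglyMeasurable w (volume.restrict (Ioo 0 T))) :
    ∀ᵐ t ∂(volume.restrict (Ioo 0 T)), f t (Q (w t)) ≤ 0 := by
  -- One null set serves the countable set `c`; demicontinuity of `Q` carries the sign to its
  -- closure, which contains almost every `w t`.
  obtain ⟨c, hc, hcr⟩ := hw.stronglyMeasurable_mk.isSeparable_range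
  have hfc : ∀ᵐ t ∂(volume.restrict (Ioo 0 T)), ∀ v ∈ c, f t (Q v) ≤ 0 :=
    (ae_ball_iff hc).2 fun v _ => hf v
  filter_upwards [hfc, hw.ae_eq_mk] with t h1 h2
  obtain ⟨d, hd, hlim⟩ := mem_closure_iff_seq_limit.1 (hcr (mem_range_self t))
  rw [← h2] at hlim
  exact le_of_tendsto' (hQ _ d hlim (f t)) fun n => h1 _ (hd n)

lemma IsSolution.smul {T : ℝ} {j : V →L[ℝ] H} {a : ℝ → V →ₗ[ℝ] V →ₗ[ℝ] ℝ}
    {f : ℝ → StrongDual ℝ V} {u₀ : H} {u : ℝ → H} (h : IsSolution T j a f u₀ u) (c : ℝ) :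
    IsSolution T j a (fun t => c • f t) (c • u₀) (fun t => c • u t) := by
  obtain ⟨w, w', hw, hwu, heq⟩ := h.equation
  refine ⟨h.continuousOn.const_smul c, by simp only [h.initial],
    fun t => c • w t, fun t => c • w' t,
    ⟨hw.memLp.const_smul c, hw.memLp_deriv.const_smul c, ?_⟩, ?_, ?_⟩
  · intro φ hφ hφc hφs
    have h1 := congrArg (c • ·) (hw.weakDeriv φ hφ hφc hφs)
    simp only [smul_neg, ← integral_smul] at h1
    have e : ∀ t, deriv φ t • toDual j (j (c • w t)) = c • deriv φ t • toDual j (j (w t)) := by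
      intro t
      ext v
      simp only [toDual, map_smul, smul_apply,
        ContinuousLinearMap.comp_apply, smul_eq_mul]
      ring
    simp only [e, smul_comm _ c, h1]
  · filter_upwards [hwu] with t ht
    rw [map_smul, ht]
  · filter_upwards [heq] with t ht z
    rw [map_smul, LinearMap.smul_apply, smul_apply,
      smul_apply, ← ht z, smul_add]

end Solution

/-! ### Energy estimate and invariance of the order intervals. -/

section Invariance

variable {Ω : Type*} [MeasurableSpace Ω] {μ : Measure Ω}
  {V : Type*} [NormedAddCommGroup V] [InnerProductSpace ℝ V] {j : V →L[ℝ] Lp ℝ 2 μ} {T : ℝ}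

lemma DualNonpos.smul {f : ℝ → StrongDual ℝ V} (hf : DualNonpos T j f) {c : ℝ} (hc : 0 ≤ c) :
    DualNonpos T j fun t => c • f t := fun v hv => by
  filter_upwards [hf v hv] with t ht
  exact mul_nonpos_of_nonneg_of_nonpos hc ht

/-- The energy estimate for `(u - 1)⁺`, given a truncation `Q` on `V` that is bounded by `C`
and along which `u` dissipates. -/
lemma IsMR.norm_sq_subOnePos_sub_le {w : ℝ → V} {w' : ℝ → StrongDual ℝ V} (hw : IsMR T j w w')
    {u : ℝ → Lp ℝ 2 μ} (hu : Continuous u)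
    (hwu : ∀ᵐ t ∂(volume.restrict (Ioo 0 T)), j (w t) = u t) {Q : V → V} {C K : ℝ}
    (hC : 0 ≤ C) (hjQ : ∀ v, j (Q v) = subOnePos (j v)) (hQ : ∀ v, ‖Q v‖ ≤ C * ‖v‖)
    (hdiss : ∀ᵐ t ∂(volume.restrict (Ioo 0 T)), w' t (Q (w t)) ≤ K * ‖subOnePos (u t)‖ ^ 2)
    {σ τ : ℝ} (hσ : σ ∈ Ioo 0 T) (hτ : τ ∈ Ioo 0 T) (hστ : σ ≤ τ) :
    ‖subOnePos (u τ)‖ ^ 2 - ‖subOnePos (u σ)‖ ^ 2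
      ≤ 2 * K * ∫ t in σ..τ, ‖subOnePos (u t)‖ ^ 2 := by
  have hψ : Continuous fun t => ‖subOnePos (u t)‖ ^ 2 :=
    (continuous_subOnePos.comp hu).norm.pow 2
  obtain ⟨g, hgm, hgL, hgw⟩ := exists_stronglyMeasurable_memLp_of_restrict measurableSet_Ioo
    hw.memLp_deriv
  obtain ⟨z, hzm, hzL, hzw⟩ := exists_stronglyMeasurable_memLp_of_restrict measurableSet_Ioo
    hw.memLp
  rw [← intervalIntegral.integral_const_mul]
  refine le_intervalIntegral_of_increment_le (k := fun t => 2 * K * ‖subOnePos (u t)‖ ^ 2)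
    (m := fun t => 2 * C * ‖z t‖) hgL hgm
    (hzL.norm.const_mul (2 * C)) (hzm.norm.const_mul (2 * C)) (fun t => by positivity)
    hψ (continuous_const.mul hψ) hστ hσ.1 ?_
  filter_upwards [hgw, hzw, (ae_restrict_iff' measurableSet_Ioo).1 hwu,
    (ae_restrict_iff' measurableSet_Ioo).1 hdiss] with t h1 h2 h3 h4 ht h hh
  have htT : t ∈ Ioo 0 T := ⟨hσ.1.trans ht.1, ht.2.trans_lt hτ.2⟩
  have hthT : t - h ∈ Ioo 0 T := ⟨by linarith [ht.1, hh.2], by linarith [htT.2, hh.1]⟩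
  have hgi : IntervalIntegrable (fun y => g (t - y)) volume 0 h := by
    have : MemLp (fun y => g (t - y)) 2 :=
      hgL.comp_measurePreserving (Measure.measurePreserving_sub_left volume t)
    rw [intervalIntegrable_iff_integrableOn_Ioc_of_le hh.1.le]
    exact (this.restrict _).integrable (by norm_num)
  have hconst : IntervalIntegrable (fun _ : ℝ => g t) volume 0 h :=
    continuous_const.intervalIntegrable _ _
  have hdi := hgi.sub hconst
  have e1 : ⟪subOnePos (u t), u t - u (t - h)⟫_ℝ = ∫ y in (0 : ℝ)..h, g (t - y) (Q (w t)) := by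
    rw [← h3 htT, ← hjQ, h3 htT,
      hw.inner_sub_eq_intervalIntegral hu hwu hthT htT (by linarith [hh.1]),
      intervalIntegral.integral_comp_sub_left (fun x => g x (Q (w t))), sub_zero]
    refine intervalIntegral.integral_congr_ae ?_
    filter_upwards [hgw] with x hx hxm
    rw [uIoc_of_le (by linarith [hh.1])] at hxm
    rw [hx ⟨hthT.1.trans hxm.1, hxm.2.trans_lt htT.2⟩]
  -- Replacing `g (t - y)` by `g t` leaves the dissipation term and a translation error.
  have e2 : ∫ y in (0 : ℝ)..h, g (t - y) (Q (w t))
      = h * g t (Q (w t)) + (∫ y in (0 : ℝ)..h, (g (t - y) - g t)) (Q (w t)) := by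
    rw [intervalIntegral.integral_sub hgi hconst, sub_apply,
      ContinuousLinearMap.intervalIntegral_apply hgi, intervalIntegral.integral_const]
    simp
  have e3 : (∫ y in (0 : ℝ)..h, (g (t - y) - g t)) (Q (w t))
      ≤ (∫ y in (0 : ℝ)..h, ‖g (t - y) - g t‖) * (C * ‖w t‖) := by
    refine (Real.le_norm_self _).trans ((ContinuousLinearMap.le_opNorm _ _).trans ?_)
    have := intervalIntegral.norm_integral_le_integral_norm (μ := volume)
      (f := fun y => g (t - y) - g t) hh.1.le
    exact mul_le_mul this (hQ _) (norm_nonneg _) ((norm_nonneg _).trans this)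
  have e4 := mul_le_mul_of_nonneg_left (h4 htT) hh.1.le
  have e5 := NonAutonomous.norm_sq_subOnePos_sub_le (u t) (u (t - h))
  rw [h1 htT] at e2 e3
  rw [e1, e2] at e5
  rw [intervalIntegral.integral_mul_const, h1 htT, h2 htT]
  linarith

lemma IsSolution.ae_le_one [CompleteSpace V] (hj : Function.Injective j) (hT : 0 < T)
    {a : ℝ → V →ₗ[ℝ] V →ₗ[ℝ] ℝ} (ha : IsClosedForm T j a)
    (h_mem : ∀ v : V, ∃ p : V, j p = infOne (j v))
    (h_form : ∀ t ∈ Icc 0 T, ∀ v p q : V, j p = infOne (j v) →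
      j q = subOnePos (j v) → 0 ≤ a t p q)
    {f : ℝ → StrongDual ℝ V} (hf : DualNonpos T j f) {u₀ : Lp ℝ 2 μ} {u : ℝ → Lp ℝ 2 μ}
    (hu : IsSolution T j a f u₀ u) (hu₀ : ∀ᵐ x ∂μ, u₀ x ≤ 1) :
    ∀ t ∈ Icc 0 T, ∀ᵐ x ∂μ, u t x ≤ 1 := by
  obtain ⟨M, hM⟩ := ha.bounded
  obtain ⟨om, α, hα, hco⟩ := ha.quasiCoercive
  obtain ⟨w, w', hw, hwu, heq⟩ := hu.equation
  choose p hp using h_mem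
  -- The positive part `(v - 1)⁺` as an element of `V`.
  set Q : V → V := fun v => v - p v with hQdef
  have hjQ : ∀ v, j (Q v) = subOnePos (j v) := fun v => by
    rw [hQdef, map_sub, hp, sub_eq_iff_eq_add', infOne_add_subOnePos]
  have hform : ∀ t ∈ Icc 0 T, ∀ v, 0 ≤ a t (v - Q v) (Q v) := fun t ht v =>
    h_form t ht v _ _ (by rw [hQdef, sub_sub_cancel, hp]) (hjQ v)
  obtain ⟨C, hC, hQ⟩ : ∃ C : ℝ, 0 ≤ C ∧ ∀ v, ‖Q v‖ ≤ C * ‖v‖ := by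
    have h0 : (0 : ℝ) ∈ Icc 0 T := ⟨le_rfl, hT.le⟩
    refine ⟨max ((M + |om| * ‖j‖ ^ 2) / α) 0, le_max_right _ _, fun v => ?_⟩
    refine (norm_le_of_quasiCoercive hα (hM 0 h0) (hco 0 h0) ?_ (hform 0 h0 v)).trans
      (mul_le_mul_of_nonneg_right (le_max_left _ _) (norm_nonneg _))
    rw [hjQ]
    exact norm_subOnePos_le _
  have hweak : ∀ (v : V) (d : ℕ → V), Tendsto d atTop (𝓝 v) → ∀ φ : StrongDual ℝ V,
      Tendsto (fun n => φ (Q (d n))) atTop (𝓝 (φ (Q v))) := by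
    intro v d hd φ
    obtain ⟨R, hR⟩ := (Metric.isBounded_range_of_tendsto d hd).exists_norm_le
    refine tendsto_apply_of_tendsto_of_injective hj (R := C * R) (fun n => (hQ _).trans
      (mul_le_mul_of_nonneg_left (hR _ (mem_range_self n)) hC)) ?_ φ
    simp only [hjQ]
    exact ((continuous_subOnePos.comp j.continuous).tendsto v).comp hd
  have hfQ : ∀ᵐ t ∂(volume.restrict (Ioo 0 T)), f t (Q (w t)) ≤ 0 :=
    ae_apply_nonpos hweak (fun v => hf (Q v) (by rw [hjQ]; exact subOnePos_nonneg _))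
      hw.memLp.aestronglyMeasurable
  -- Constant extension of `u` beyond `[0, T]`, continuous on the whole line.
  set U : ℝ → Lp ℝ 2 μ := IccExtend hT.le (domRestrict (Icc 0 T) u) with hUdef
  have hU : Continuous U := continuous_IccExtend_iff.2 hu.continuousOn.domRestrict
  have hUu : ∀ t ∈ Icc 0 T, U t = u t := fun t ht => IccExtend_of_mem hT.le _ ht
  have hwU : ∀ᵐ t ∂(volume.restrict (Ioo 0 T)), j (w t) = U t := by
    filter_upwards [hwu, ae_restrict_mem measurableSet_Ioo] with t h1 h2
    rw [h1, hUu t (Ioo_subset_Icc_self h2)]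
  -- Split `a(w, Qw) = a(w - Qw, Qw) + a(Qw, Qw)`: the first term is nonnegative, the second at
  -- least `-om ‖j(Qw)‖²`.
  have hdiss : ∀ᵐ t ∂(volume.restrict (Ioo 0 T)),
      w' t (Q (w t)) ≤ om * ‖subOnePos (U t)‖ ^ 2 := by
    filter_upwards [heq, hfQ, hwU, ae_restrict_mem measurableSet_Ioo] with t h1 h2 h3 h4
    have h5 := hform t (Ioo_subset_Icc_self h4) (w t)
    have h6 := hco t (Ioo_subset_Icc_self h4) (Q (w t))
    have h7 := h1 (Q (w t))
    rw [LinearMap.map_sub₂] at h5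
    rw [hjQ, h3] at h6
    have : 0 ≤ α * ‖Q (w t)‖ ^ 2 := by positivity
    linarith
  have hψ : Continuous fun t => ‖subOnePos (U t)‖ ^ 2 :=
    (continuous_subOnePos.comp hU).norm.pow 2
  have hzero : ∀ t ∈ Ico 0 T, ‖subOnePos (U t)‖ ^ 2 = 0 :=
    eq_zero_of_le_mul_integral (K := 2 * om) hψ (fun t => sq_nonneg _) (by
      rw [hUu 0 ⟨le_rfl, hT.le⟩, hu.initial, (subOnePos_eq_zero_iff _).2 hu₀]
      simp)
      fun σ hσ τ hτ hστ => hw.norm_sq_subOnePos_sub_le hU hwU hC hjQ hQ hdiss hσ hτ hστ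
  have hclosed : IsClosed {t | ‖subOnePos (U t)‖ ^ 2 = 0} := isClosed_eq hψ continuous_const
  have hsub := hclosed.closure_subset_iff.2 hzero
  rw [closure_Ico hT.ne] at hsub
  intro t ht
  rw [← hUu t ht, ← subOnePos_eq_zero_iff]
  simpa using hsub ht

/-- By linearity `n u` solves the problem with data `n f ≤ 0` and `n u₀ ≤ 0 ≤ 1`, so `n u ≤ 1` for
every `n`. -/
lemma IsSolution.ae_nonpos [CompleteSpace V] (hj : Function.Injective j) (hT : 0 < T)
    {a : ℝ → V →ₗ[ℝ] V →ₗ[ℝ] ℝ} (ha : IsClosedForm T j a)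
    (h_mem : ∀ v : V, ∃ p : V, j p = infOne (j v))
    (h_form : ∀ t ∈ Icc 0 T, ∀ v p q : V, j p = infOne (j v) →
      j q = subOnePos (j v) → 0 ≤ a t p q)
    {f : ℝ → StrongDual ℝ V} (hf : DualNonpos T j f) {u₀ : Lp ℝ 2 μ} {u : ℝ → Lp ℝ 2 μ}
    (hu : IsSolution T j a f u₀ u) (hu₀ : ∀ᵐ x ∂μ, u₀ x ≤ 0) :
    ∀ t ∈ Icc 0 T, ∀ᵐ x ∂μ, u t x ≤ 0 := by
  intro t ht
  have key : ∀ n : ℕ, ∀ᵐ x ∂μ, (n : ℝ) * u t x ≤ 1 := fun n => by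
    have h0 : ∀ᵐ x ∂μ, ((n : ℝ) • u₀) x ≤ 1 := by
      filter_upwards [hu₀, Lp.coeFn_smul (n : ℝ) u₀] with x h1 h2
      rw [h2]
      exact (mul_nonpos_of_nonneg_of_nonpos n.cast_nonneg h1).trans zero_le_one
    filter_upwards [(hu.smul n).ae_le_one hj hT ha h_mem h_form (hf.smul n.cast_nonneg) h0 t ht,
      Lp.coeFn_smul (n : ℝ) (u t)] with x h1 h2
    rwa [h2] at h1
  filter_upwards [ae_all_iff.2 key] with x hx
  by_contra! h
  obtain ⟨n, hn⟩ := exists_nat_gt (u t x)⁻¹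
  have := mul_lt_mul_of_pos_right hn h
  rw [inv_mul_cancel₀ h.ne'] at this
  exact absurd (hx n) (not_le.2 this)

end Invariance

end NonAutonomous

theorem mainTheorem4 {Ω : Type*} [MeasurableSpace Ω] (μ : Measure Ω)
    {V : Type*} [NormedAddCommGroup V] [InnerProductSpace ℝ V] [CompleteSpace V]
    (j : V →L[ℝ] Lp ℝ 2 μ) (hj_inj : Function.Injective j) (hj_dense : DenseRange j)
    (T : ℝ) (hT : 0 < T)
    (a : ℝ → V →ₗ[ℝ] V →ₗ[ℝ] ℝ) (ha : NonAutonomous.IsClosedForm T j a)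
    (h_mem : ∀ v : V, ∃ p : V, j p = NonAutonomous.infOne (j v))
    (h_form : ∀ t ∈ Icc 0 T, ∀ v p q : V, j p = NonAutonomous.infOne (j v) →
      j q = NonAutonomous.subOnePos (j v) → 0 ≤ a t p q)
    (f : ℝ → StrongDual ℝ V) (hf : MemLp f 2 (volume.restrict (Ioo 0 T)))
    (hf_nonpos : NonAutonomous.DualNonpos T j f)
    (u₀ : Lp ℝ 2 μ) (u : ℝ → Lp ℝ 2 μ) (hu : NonAutonomous.IsSolution T j a f u₀ u) :
    ((∀ᵐ x ∂μ, u₀ x ≤ 1) → ∀ t ∈ Icc 0 T, ∀ᵐ x ∂μ, u t x ≤ 1) ∧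
    ((∀ᵐ x ∂μ, u₀ x ≤ 0) → ∀ t ∈ Icc 0 T, ∀ᵐ x ∂μ, u t x ≤ 0) := by
  exact ⟨fun h => hu.ae_le_one hj_inj hT ha h_mem h_form hf_nonpos h,
    fun h => hu.ae_nonpos hj_inj hT ha h_mem h_form hf_nonpos h⟩
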